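/- Setting. $L$ users transmit to a single relay with power $P>0$ (unit noise variance). In slot $n=1,2,\dots$ the channel vector is $\mathbf h_L(n)=(h_1(n),\dots,h_L(n))$, where all $h_l(n)$ are i.i.d. $\mathcal N(0,1)$ over users and slots. In each slot a scheduling algorithm selects a set $\mathcal S(n)\subseteq\{1,\dots,L\}$ of transmitting users and a nonzero integer coefficient vector $\mathbf a(n)$ for them (extended by zeros to $\mathbb Z^L$), and it fixes a common transmission rate $R\ge 0$; the choices may be any measurable functions of all channel realizations and of additional randomness. With $\mathbf h(n)$ the channel vector of the scheduled users, the achievable compute-and-forward (CF) rate of slot $n$ is $$\mathcal R(\mathbf h(n),\mathbf a(n))=\tfrac12\log^+\Big(\|\mathbf a(n)\|^2-\frac{P(\mathbf h(n)^T\mathbf a(n))^2}{1+P\|\mathbf h(n)\|^2}\Big)^{-1},\qquad \log=\log_2,\ \log^+x=\max\{\log x,0\}.$$ Let $N$ be the first slot after which the matrix with rows $\mathbf a(1),\dots,\mathbf a(N)$ has rank $L$ (over a given field, e.g. $\mathbb F_p$ or $\mathbb R$). The system sum-rate is $C_{SR}=RL/N$ if $N<\infty$ and $R\le\min_{n\le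 N}\mathcal R(\mathbf h(n),\mathbf a(n))$, and $C_{SR}=0$ if decoding fails. Theorem. There is a sequence $o(1)\to0$ as $L\to\infty$, depending only on $L$, such that for every $P>0$, every $L\ge2$ and every scheduling algorithm, $C_{SR}$ is integrable and $$\mathbb E[C_{SR}]\le\tfrac12\log\Big(1+P\big(2\ln L-\ln\ln L-2\ln\Gamma(\tfrac12)+\tfrac{\gamma}{2}+o(1)\big)\Big),$$ where $\gamma$ is the Euler–Mascheroni constant and the argument of the logarithm is positive. Consequently the expected sum-rate of any scheduling algorithm scales at most as $\tfrac12\log\log L$: for every $P>0$ and $\eta>0$ there is $L_0$ such that $\mathbb E[C_{SR}]\le(1+\eta)\,\tfrac12\log\log L$ for all $L\ge L_0$ and all scheduling algorithms. -/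

import Mathlib

open Filter Topology MeasureTheory ProbabilityTheory

noncomputable section

namespace CF

/-- `log⁺ x = max (log x) 0`; logarithms of rates are to base 2 (rates are in bits). -/
def log2Plus (x : ℝ) : ℝ := max (Real.logb 2 x) 0

/-- The effective noise level `‖a‖² - P (hᵀa)² / (1 + P ‖h‖²)` for the MMSE scaling. -/
def effNoise {ι : Type*} [Fintype ι] (P : ℝ) (h : ι → ℝ) (a : ι → ℤ) : ℝ :=
  (∑ i, (a i : ℝ) ^ 2) - P * (∑ i, h i * (a i : ℝ)) ^ 2 / (1 + P * ∑ i, h i ^ 2)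

/-- The achievable (computation) rate
`R(h, a) = (1/2) log⁺ (‖a‖² - P (hᵀa)² / (1 + P ‖h‖²))⁻¹`. -/
def compRate {ι : Type*} [Fintype ι] (P : ℝ) (h : ι → ℝ) (a : ι → ℤ) : ℝ :=
  1 / 2 * log2Plus (effNoise P h a)⁻¹

/-- Completing the square: the effective noise as a function of the scaling `α` at the relay. -/
theorem scaledNoise_eq {ι : Type*} [Fintype ι] {P : ℝ} (hP : 0 < P) (h : ι → ℝ) (a : ι → ℤ)
    (α : ℝ) :
    α ^ 2 + P * ∑ i, (α * h i - a i) ^ 2 =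
      (1 + P * ∑ i, h i ^ 2) *
        (α - P * (∑ i, h i * a i) / (1 + P * ∑ i, h i ^ 2)) ^ 2 + P * effNoise P h a := by
  have h0 : 0 < 1 + P * ∑ i, h i ^ 2 := by positivity
  have e : ∑ i, (α * h i - a i) ^ 2 =
      α ^ 2 * ∑ i, h i ^ 2 - 2 * α * (∑ i, h i * a i) + ∑ i, (a i : ℝ) ^ 2 := by
    rw [Finset.mul_sum, Finset.mul_sum, ← Finset.sum_sub_distrib, ← Finset.sum_add_distrib]
    exact Finset.sum_congr rfl fun i _ => by ring
  rw [e]; unfold effNoise; field_simp; ring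

/-- The effective noise level is positive for `a ≠ 0`, so no logarithm below is a junk value. -/
theorem effNoise_pos {ι : Type*} [Fintype ι] {P : ℝ} (hP : 0 < P) (h : ι → ℝ) {a : ι → ℤ}
    (ha : a ≠ 0) : 0 < effNoise P h a := by
  have key := scaledNoise_eq hP h a (P * (∑ i, h i * a i) / (1 + P * ∑ i, h i ^ 2))
  set α := P * (∑ i, h i * a i) / (1 + P * ∑ i, h i ^ 2)
  rw [sub_self] at key
  have hpos : 0 < α ^ 2 + P * ∑ i, (α * h i - a i) ^ 2 := by
    rcases eq_or_ne α 0 with h0 | h0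
    · obtain ⟨i, hi⟩ := Function.ne_iff.mp ha
      have hi' : (a i : ℝ) ≠ 0 := by exact_mod_cast hi
      have : 0 < ∑ i, (α * h i - a i) ^ 2 :=
        Finset.sum_pos' (fun _ _ => sq_nonneg _) ⟨i, Finset.mem_univ _, by
          rw [h0, zero_mul, zero_sub, neg_sq]; positivity⟩
      positivity
    · positivity
  have h2 : 0 < P * effNoise P h a := by nlinarith
  exact (mul_pos_iff_of_pos_left hP).mp h2

/-- `compRate` is the maximum over the scaling `α` of
`(1/2) log⁺ (P / (α² + P ‖α h - a‖²))`. -/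
theorem isGreatest_compRate {ι : Type*} [Fintype ι] {P : ℝ} (hP : 0 < P) (h : ι → ℝ) {a : ι → ℤ}
    (ha : a ≠ 0) :
    IsGreatest (Set.range fun α : ℝ =>
      1 / 2 * log2Plus (P / (α ^ 2 + P * ∑ i, (α * h i - a i) ^ 2))) (compRate P h a) := by
  have hn := effNoise_pos hP h ha
  have h0 : 0 < 1 + P * ∑ i, h i ^ 2 := by positivity
  constructor
  · refine ⟨P * (∑ i, h i * a i) / (1 + P * ∑ i, h i ^ 2), ?_⟩
    simp only [scaledNoise_eq hP h a, compRate, sub_self]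
    congr 2
    field_simp
    simp
  · rintro _ ⟨α, rfl⟩
    simp only [scaledNoise_eq hP h a, compRate, log2Plus]
    have hle : P / ((1 + P * ∑ i, h i ^ 2) *
        (α - P * (∑ i, h i * a i) / (1 + P * ∑ i, h i ^ 2)) ^ 2 + P * effNoise P h a) ≤
        (effNoise P h a)⁻¹ := by
      rw [div_le_iff₀ (by positivity), mul_add, ← div_eq_inv_mul, ← div_eq_inv_mul,
        mul_div_cancel_right₀ _ hn.ne']
      have : 0 ≤ ((1 + P * ∑ i, h i ^ 2) *
        (α - P * (∑ i, h i * a i) / (1 + P * ∑ i, h i ^ 2)) ^ 2) / effNoise P h a := by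
        positivity
      linarith
    have := Real.logb_le_logb_of_le (b := 2) (by norm_num) (by positivity) hle
    gcongr

/-- The channel gains `h n l` (slot `n`, user `l`) of a single relay: standard normal,
independent over the users and over the slots. -/
structure IsChannel {L : ℕ} {Ω : Type*} [MeasurableSpace Ω] (μ : Measure Ω)
    (h : ℕ → Fin L → Ω → ℝ) : Prop where
  measurable : ∀ n l, Measurable (h n l)
  law : ∀ n l, μ.map (h n l) = gaussianReal 0 1
  indep : iIndepFun (fun (s : ℕ × Fin L) => h s.1 s.2) μ

/-- A scheduling algorithm for `L` users and one relay. In every slot `n` it picks the set of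
transmitting users and a nonzero integer coefficient vector for them (written as a vector of
length `L` that vanishes on the users which are not scheduled); it also sets the common
transmission rate of the users. All choices may depend in any measurable way on the outcome `ω`,
that is, on all channel realizations and on additional randomness. -/
structure SchedulingAlgorithm (L : ℕ) (Ω : Type*) [MeasurableSpace Ω] where
  users : ℕ → Ω → Finset (Fin L)
  coeff : ℕ → Ω → Fin L → ℤ
  txRate : Ω → ℝ
  coeff_ne_zero : ∀ n ω, coeff n ω ≠ 0
  coeff_eq_zero : ∀ n ω, ∀ l ∉ users n ω, coeff n ω l = 0
  txRate_nonneg : ∀ ω, 0 ≤ txRate ω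
  measurableSet_users : ∀ n S, MeasurableSet {ω | users n ω = S}
  measurable_coeff : ∀ n, Measurable (coeff n)
  measurable_txRate : Measurable txRate

namespace SchedulingAlgorithm

variable {L : ℕ} {Ω : Type*} [MeasurableSpace Ω]

/-- The computation rate at the relay in slot `n`: only the scheduled users transmit, so the
channel vector and the coefficient vector are those of the scheduled users. -/
def slotRate (𝒜 : SchedulingAlgorithm L Ω) (P : ℝ) (h : ℕ → Fin L → Ω → ℝ) (n : ℕ) (ω : Ω) : ℝ :=
  compRate P (fun l : 𝒜.users n ω => h n l ω) (fun l : 𝒜.users n ω => 𝒜.coeff n ω l)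

/-- The decoding matrix after `n` slots, with entries read in the field `K` over which the
destination solves the linear system. -/
def decodingMatrix (𝒜 : SchedulingAlgorithm L Ω) (K : Type*) [Field K] (n : ℕ) (ω : Ω) :
    Matrix (Fin n) (Fin L) K :=
  Matrix.of fun i l => (𝒜.coeff i ω l : K)

/-- The numbers of slots after which the decoding matrix has full rank `L`. -/
def fullRankTimes (𝒜 : SchedulingAlgorithm L Ω) (K : Type*) [Field K] (ω : Ω) : Set ℕ :=
  {n | (𝒜.decodingMatrix K n ω).rank = L}

/-- The completion time `N`: the first slot at which the decoding matrix has rank `L`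
(meaningful when there is such a slot). -/
def completionTime (𝒜 : SchedulingAlgorithm L Ω) (K : Type*) [Field K] (ω : Ω) : ℕ :=
  sInf (𝒜.fullRankTimes K ω)

/-- Successful decoding: full rank is reached, and the transmission rate is supported by the
computation rates of all slots up to completion. -/
def Decodes (𝒜 : SchedulingAlgorithm L Ω) (K : Type*) [Field K] (P : ℝ)
    (h : ℕ → Fin L → Ω → ℝ) (ω : Ω) : Prop :=
  (𝒜.fullRankTimes K ω).Nonempty ∧
    ∀ n < 𝒜.completionTime K ω, 𝒜.txRate ω ≤ 𝒜.slotRate P h n ω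

open scoped Classical in
/-- The system sum-rate `C_SR = R L / N`, and `0` if the messages are never decoded. -/
def sumRate (𝒜 : SchedulingAlgorithm L Ω) (K : Type*) [Field K] (P : ℝ)
    (h : ℕ → Fin L → Ω → ℝ) (ω : Ω) : ℝ :=
  if 𝒜.Decodes K P h ω then 𝒜.txRate ω * (L : ℝ) / (𝒜.completionTime K ω : ℝ) else 0

end SchedulingAlgorithm

end CF

end

/-! Full rank `L` needs at least `L` slots, so `RL/N ≤ R`, and `R` must be supported in each of the
first `L` slots. A slot's rate is at most `½ log(1 + P h²)` for any user with nonzero coefficient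
(`compRate_le`). Hence, whatever the scheduler does, the sum-rate is at most `½ log(1 + P M)`, where
`M` is the minimum over `L` independent slots of the largest gain in the slot (`sumRate_le`).

This minimum lies below the typical maximum. With `t = 2 ln L - (3/2) ln ln L`, a slot has all gains
at most `t` with probability at least `L^(-1/2)`, so all `L` slots exceed `t` with probability at
most `exp(-√L)` (`measureReal_strongSlots_le`). On that event `M` is replaced by the total gain of
slot `0`, which contributes at most `1` to the mean (`integral_strongGain_le_add`). Jensen's
inequality gives `½ log(1 + P (t + 1))`, and `t + 1` is eventually below the claimed centering, with
slack of order `½ ln ln L`. The `o(1)` term is therefore needed only for finitely many `L`. -/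

noncomputable section

namespace CF

/-! ### Pointwise bound on the sum-rate by the gains of one slot -/

/-- The rate is limited by the gain of any single participating user. -/
theorem compRate_le {ι : Type*} [Fintype ι] {P : ℝ} (hP : 0 < P) (h : ι → ℝ) {a : ι → ℤ}
    {i : ι} (hi : a i ≠ 0) : compRate P h a ≤ 1 / 2 * Real.logb 2 (1 + P * h i ^ 2) := by
  have ha : a ≠ 0 := fun h0 => hi (by simp [h0])
  obtain ⟨⟨α, hα⟩, -⟩ := isGreatest_compRate hP h ha
  rw [← hα]
  have h1 : (1 : ℝ) ≤ (a i : ℝ) ^ 2 := by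
    have : 1 ≤ (a i) ^ 2 := Int.one_le_abs hi |> fun h => by nlinarith [sq_abs (a i)]
    exact_mod_cast this
  have h2 : (α * h i - a i) ^ 2 ≤ ∑ j, (α * h j - a j) ^ 2 :=
    Finset.single_le_sum (f := fun j => (α * h j - a j) ^ 2) (fun _ _ => sq_nonneg _)
      (Finset.mem_univ i)
  set S := ∑ j, (α * h j - a j) ^ 2
  have hS : 0 ≤ S := (sq_nonneg _).trans h2
  have key : P ≤ (1 + P * h i ^ 2) * (α ^ 2 + P * S) := by
    -- Cauchy–Schwarz: the right side minus `P * a i ^ 2` is exactly the square given to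
    -- `nlinarith`. Integrality enters through `1 ≤ a i ^ 2`.
    have h3 : P * (a i : ℝ) ^ 2 ≤ (1 + P * h i ^ 2) * (α ^ 2 + P * (α * h i - a i) ^ 2) := by
      nlinarith [sq_nonneg (α + P * h i * (α * h i - a i))]
    have h4 : (1 + P * h i ^ 2) * (α ^ 2 + P * (α * h i - a i) ^ 2) ≤
        (1 + P * h i ^ 2) * (α ^ 2 + P * S) := by gcongr
    nlinarith
  have hpos : 0 < α ^ 2 + P * S := by
    by_contra hn
    have : (1 + P * h i ^ 2) * (α ^ 2 + P * S) ≤ 0 :=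
      mul_nonpos_of_nonneg_of_nonpos (by positivity) (not_lt.mp hn)
    linarith
  refine mul_le_mul_of_nonneg_left ?_ (by norm_num)
  refine max_le ?_ (Real.logb_nonneg (by norm_num) (by nlinarith [sq_nonneg (h i)]))
  refine Real.logb_le_logb_of_le (by norm_num) (by positivity) ?_
  rwa [div_le_iff₀ hpos]

namespace SchedulingAlgorithm

variable {L : ℕ} {Ω : Type*} [MeasurableSpace Ω] (𝒜 : SchedulingAlgorithm L Ω)

theorem slotRate_le {P : ℝ} (hP : 0 < P) (h : ℕ → Fin L → Ω → ℝ) (n : ℕ) (ω : Ω) :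
    ∃ l, 𝒜.slotRate P h n ω ≤ 1 / 2 * Real.logb 2 (1 + P * h n l ω ^ 2) := by
  obtain ⟨l, hl⟩ := Function.ne_iff.mp (𝒜.coeff_ne_zero n ω)
  have hu : l ∈ 𝒜.users n ω := by
    by_contra hu
    exact hl (𝒜.coeff_eq_zero n ω l hu)
  exact ⟨l, compRate_le hP (fun l : 𝒜.users n ω => h n l ω) (i := ⟨l, hu⟩) hl⟩

theorem le_completionTime (K : Type*) [Field K] {ω : Ω} (hne : (𝒜.fullRankTimes K ω).Nonempty) :
    L ≤ 𝒜.completionTime K ω := by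
  have h : (𝒜.decodingMatrix K (𝒜.completionTime K ω) ω).rank = L := Nat.sInf_mem hne
  have := (𝒜.decodingMatrix K (𝒜.completionTime K ω) ω).rank_le_height
  omega

theorem sumRate_nonneg (K : Type*) [Field K] (P : ℝ) (h : ℕ → Fin L → Ω → ℝ) (ω : Ω) :
    0 ≤ 𝒜.sumRate K P h ω := by
  unfold sumRate
  split_ifs
  · have := 𝒜.txRate_nonneg ω
    positivity
  · exact le_rfl

/-- Since `L ≤ N`, every slot `n < L` precedes completion, so its rate caps `R`, while `RL/N ≤ R`.
The slot `n` may depend on `ω`, which lets the weakest slot be used. -/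
theorem sumRate_le (K : Type*) [Field K] {P : ℝ} (hP : 0 < P) (h : ℕ → Fin L → Ω → ℝ) (ω : Ω)
    {n : ℕ} (hn : n < L) {y : ℝ} (hy : ∀ l, h n l ω ^ 2 ≤ y) :
    𝒜.sumRate K P h ω ≤ 1 / 2 * Real.logb 2 (1 + P * y) := by
  obtain ⟨l, hl⟩ := 𝒜.slotRate_le hP h n ω
  have hy0 : 0 ≤ y := (sq_nonneg _).trans (hy l)
  unfold sumRate
  split_ifs with hd
  · have hN := 𝒜.le_completionTime K hd.1
    have hN0 : (0 : ℝ) < 𝒜.completionTime K ω := by exact_mod_cast (by omega)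
    have h1 : 𝒜.txRate ω * (L : ℝ) / (𝒜.completionTime K ω : ℝ) ≤ 𝒜.txRate ω := by
      rw [div_le_iff₀ hN0]
      exact mul_le_mul_of_nonneg_left (by exact_mod_cast hN) (𝒜.txRate_nonneg ω)
    refine h1.trans ((hd.2 n (hn.trans_le hN)).trans (hl.trans ?_))
    gcongr
    · norm_num
    · exact hy l
  · have : 0 ≤ Real.logb 2 (1 + P * y) :=
      Real.logb_nonneg (by norm_num) (by nlinarith [mul_nonneg hP.le hy0])
    linarith

/-! ### Measurability of the sum-rate -/

theorem measurable_slotRate (P : ℝ) {h : ℕ → Fin L → Ω → ℝ} (hm : ∀ n l, Measurable (h n l))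
    (n : ℕ) : Measurable (𝒜.slotRate P h n) := by
  have hU : ∀ l, MeasurableSet {ω | l ∈ 𝒜.users n ω} := fun l => by
    have : {ω | l ∈ 𝒜.users n ω} = ⋃ S : Finset (Fin L), ⋃ _ : l ∈ S, {ω | 𝒜.users n ω = S} := by
      ext ω; simp
    rw [this]
    exact MeasurableSet.iUnion fun S => MeasurableSet.iUnion fun _ => 𝒜.measurableSet_users n S
  -- The index type of the sum varies with `ω`; indicators turn it into a sum over all of `Fin L`.
  have hsum : ∀ f : Fin L → Ω → ℝ, (∀ l, Measurable (f l)) →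
      Measurable fun ω => ∑ l : 𝒜.users n ω, f l ω := fun f hf => by
    have : (fun ω => ∑ l : 𝒜.users n ω, f l ω) =
        fun ω => ∑ l, Set.indicator {ω | l ∈ 𝒜.users n ω} (f l) ω := by
      ext ω
      rw [Finset.sum_coe_sort (𝒜.users n ω) (fun l => f l ω)]
      simp [Set.indicator_apply, Finset.sum_ite_mem]
    rw [this]
    exact Finset.measurable_sum _ fun l _ => (hf l).indicator (hU l)
  have hc : ∀ l, Measurable fun ω => (𝒜.coeff n ω l : ℝ) := fun l =>
    (measurable_from_top (f := fun z : ℤ => (z : ℝ))).comp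
      ((measurable_pi_apply l).comp (𝒜.measurable_coeff n))
  have h1 := hsum (fun l ω => (𝒜.coeff n ω l : ℝ) ^ 2) fun l => (hc l).pow_const 2
  have h2 := hsum (fun l ω => h n l ω * (𝒜.coeff n ω l : ℝ)) fun l => (hm n l).mul (hc l)
  have h3 := hsum (fun l ω => h n l ω ^ 2) fun l => (hm n l).pow_const 2
  have h4 : Measurable fun ω => effNoise P (fun l : 𝒜.users n ω => h n l ω)
      (fun l : 𝒜.users n ω => 𝒜.coeff n ω l) :=
    h1.sub (((h2.pow_const 2).const_mul P).div ((h3.const_mul P).const_add 1))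
  have h5 : Measurable fun x : ℝ => 1 / 2 * log2Plus x⁻¹ := by
    unfold log2Plus Real.logb
    fun_prop
  exact h5.comp h4

theorem measurableSet_mem_fullRankTimes (K : Type*) [Field K] (n : ℕ) :
    MeasurableSet {ω | n ∈ 𝒜.fullRankTimes K ω} := by
  have h1 : Measurable fun ω => fun i : Fin n => 𝒜.coeff i ω :=
    measurable_pi_lambda _ fun i => 𝒜.measurable_coeff i
  -- Integer coefficient tuples form a countable space, so the rank condition is measurable for
  -- every field `K`.
  exact h1 (Set.to_countable
    {c : Fin n → Fin L → ℤ | (Matrix.of fun i l => (c i l : K)).rank = L}).measurableSet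

theorem measurable_completionTime (K : Type*) [Field K] : Measurable (𝒜.completionTime K) := by
  have hm := 𝒜.measurableSet_mem_fullRankTimes K
  refine measurable_to_countable' fun n => ?_
  -- The second set accounts for `sInf ∅ = 0`, when full rank is never reached.
  have : 𝒜.completionTime K ⁻¹' {n} =
      ({ω | n ∈ 𝒜.fullRankTimes K ω} ∩ ⋂ k, ⋂ _ : k < n, {ω | k ∈ 𝒜.fullRankTimes K ω}ᶜ) ∪
        ({_ω | n = 0} ∩ ⋂ k, {ω | k ∈ 𝒜.fullRankTimes K ω}ᶜ) := by
    ext ω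
    simp only [Set.mem_preimage, Set.mem_singleton_iff, Set.mem_union, Set.mem_inter_iff,
      Set.mem_iInter, Set.mem_compl_iff, Set.mem_ofPred_eq, completionTime]
    constructor
    · rintro rfl
      rcases (𝒜.fullRankTimes K ω).eq_empty_or_nonempty with h0 | h0
      · right; simp [h0]
      · exact Or.inl ⟨Nat.sInf_mem h0, fun k hk => Nat.notMem_of_lt_sInf hk⟩
    · rintro (⟨h1, h2⟩ | ⟨rfl, h2⟩)
      · refine le_antisymm (Nat.sInf_le h1) ?_
        by_contra hlt
        exact h2 _ (not_le.mp hlt) (Nat.sInf_mem ⟨n, h1⟩)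
      · simp [Set.eq_empty_of_forall_notMem h2]
  rw [this]
  refine ((hm n).inter (MeasurableSet.iInter fun k => MeasurableSet.iInter fun _ =>
    (hm k).compl)).union ((MeasurableSet.const _).inter (MeasurableSet.iInter fun k => (hm k).compl))

theorem measurable_sumRate (K : Type*) [Field K] (P : ℝ) {h : ℕ → Fin L → Ω → ℝ}
    (hm : ∀ n l, Measurable (h n l)) : Measurable (𝒜.sumRate K P h) := by
  have hD : MeasurableSet {ω | 𝒜.Decodes K P h ω} := by
    have : {ω | 𝒜.Decodes K P h ω} = (⋃ n, {ω | n ∈ 𝒜.fullRankTimes K ω}) ∩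
        ⋂ n, ({ω | n < 𝒜.completionTime K ω}ᶜ ∪ {ω | 𝒜.txRate ω ≤ 𝒜.slotRate P h n ω}) := by
      ext ω
      simp [Decodes, Set.Nonempty, imp_iff_not_or]
    rw [this]
    refine (MeasurableSet.iUnion fun n => 𝒜.measurableSet_mem_fullRankTimes K n).inter
      (MeasurableSet.iInter fun n => MeasurableSet.union (MeasurableSet.compl ?_) ?_)
    · exact measurableSet_lt measurable_const (𝒜.measurable_completionTime K)
    · exact measurableSet_le 𝒜.measurable_txRate (𝒜.measurable_slotRate P hm n)
  unfold sumRate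
  exact Measurable.ite hD ((𝒜.measurable_txRate.mul_const _).div
    (measurable_from_top.comp (𝒜.measurable_completionTime K))) measurable_const

end SchedulingAlgorithm

/-! ### Gaussian tails and the probability that all slots are strong -/

/-- Two-sided Chernoff bound for the square of a standard normal variable. -/
theorem measureReal_gaussian_lt_sq_le {t : ℝ} (ht : 0 ≤ t) :
    (gaussianReal 0 1).real {x | t < x ^ 2} ≤ 2 * Real.exp (-t / 2) := by
  have hs := Real.sq_sqrt ht
  have hs0 := Real.sqrt_nonneg t
  set s := Real.sqrt t
  have hint : ∀ u : ℝ, Integrable (fun x => Real.exp (u * id x)) (gaussianReal 0 1) :=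
    fun u => integrable_exp_mul_gaussianReal u
  -- The parameters `±s` are the optimal Chernoff exponents for the thresholds `±s`.
  have h1 := measure_ge_le_exp_mul_mgf (X := id) s hs0 (hint s)
  have h2 := measure_le_le_exp_mul_mgf (X := id) (-s) (neg_nonpos.mpr hs0) (hint (-s))
  rw [mgf_id_gaussianReal] at h1 h2
  have e1 : Real.exp (-s * s) * Real.exp (0 * s + (1 : NNReal) * s ^ 2 / 2) =
      Real.exp (-t / 2) := by
    rw [← Real.exp_add, ← hs]; congr 1; push_cast; ring
  have e2 : Real.exp (-(-s) * (-s)) * Real.exp (0 * (-s) + (1 : NNReal) * (-s) ^ 2 / 2) =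
      Real.exp (-t / 2) := by
    rw [← Real.exp_add, ← hs]; congr 1; push_cast; ring
  simp only [e1] at h1
  simp only [e2] at h2
  have hsub : {x : ℝ | t < x ^ 2} ⊆ {x | s ≤ id x} ∪ {x | id x ≤ -s} := by
    intro x hx
    have hx : t < x ^ 2 := hx
    by_contra hn
    simp only [Set.mem_union, Set.mem_ofPred_eq, id, not_or, not_le] at hn
    nlinarith
  calc _ ≤ _ := measureReal_mono hsub
    _ ≤ _ := measureReal_union_le _ _
    _ ≤ _ := by linarith

section Channel

variable {L : ℕ} {Ω : Type*} [MeasurableSpace Ω] {μ : Measure Ω} {h : ℕ → Fin L → Ω → ℝ}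

/-- The event that in each of the first `L` slots some user has gain exceeding `t`. -/
def strongSlots (h : ℕ → Fin L → Ω → ℝ) (t : ℝ) : Set Ω :=
  {ω | ∀ n < L, ∃ l, t < h n l ω ^ 2}

/-- The event that all users have gain at most `t` in slot `n`. -/
def weakSlot (h : ℕ → Fin L → Ω → ℝ) (t : ℝ) (n : ℕ) : Set Ω :=
  ⋂ l, h n l ⁻¹' {x | x ^ 2 ≤ t}

theorem measurableSet_sq_le (t : ℝ) : MeasurableSet {x : ℝ | x ^ 2 ≤ t} :=
  measurableSet_le (by fun_prop) measurable_const

theorem strongSlots_eq {Ω : Type*} (h : ℕ → Fin L → Ω → ℝ) (t : ℝ) :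
    strongSlots h t = ⋂ n ∈ Finset.range L, (weakSlot h t n)ᶜ := by
  ext ω
  simp [strongSlots, weakSlot]

namespace IsChannel

variable (hc : IsChannel μ h)
include hc

theorem measurableSet_weakSlot (t : ℝ) (n : ℕ) : MeasurableSet (weakSlot h t n) :=
  MeasurableSet.iInter fun l => hc.measurable n l (measurableSet_sq_le t)

theorem measurableSet_strongSlots (t : ℝ) : MeasurableSet (strongSlots h t) := by
  rw [strongSlots_eq]
  exact Finset.measurableSet_biInter _ fun n _ => (hc.measurableSet_weakSlot t n).compl

/-- An arbitrary finite set of slots is allowed because this yields both the independence of the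
weak slots and, for singletons, their probability. -/
theorem measure_biInter_weakSlot (t : ℝ) (s : Finset ℕ) :
    μ (⋂ n ∈ s, weakSlot h t n) = ∏ _n ∈ s, gaussianReal 0 1 {x | x ^ 2 ≤ t} ^ L := by
  have h1 := hc.indep.measure_inter_preimage_eq_mul (s ×ˢ Finset.univ)
    (sets := fun _ => {x : ℝ | x ^ 2 ≤ t}) fun _ _ => measurableSet_sq_le t
  have h2 : ⋂ n ∈ s, weakSlot h t n =
      ⋂ i ∈ s ×ˢ (Finset.univ : Finset (Fin L)), h i.1 i.2 ⁻¹' {x | x ^ 2 ≤ t} := by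
    ext ω
    simp [weakSlot]
    exact ⟨fun H a b ha => H a ha b, fun H a ha b => H a b ha⟩
  rw [h2, h1, Finset.prod_product]
  refine Finset.prod_congr rfl fun n _ => ?_
  rw [Finset.prod_congr rfl fun l _ => ?_, Finset.prod_const, Finset.card_univ, Fintype.card_fin]
  rw [← hc.law n l, Measure.map_apply (hc.measurable n l) (measurableSet_sq_le t)]

theorem iIndepSet_weakSlot (t : ℝ) : iIndepSet (weakSlot h t) μ := by
  rw [iIndepSet_iff_meas_biInter (hc.measurableSet_weakSlot t)]
  intro s
  rw [hc.measure_biInter_weakSlot]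
  refine Finset.prod_congr rfl fun n _ => ?_
  simpa using (hc.measure_biInter_weakSlot t {n}).symm

theorem measureReal_strongSlots [IsProbabilityMeasure μ] (t : ℝ) :
    μ.real (strongSlots h t) = (1 - (1 - (gaussianReal 0 1).real {x | t < x ^ 2}) ^ L) ^ L := by
  have hi := (iIndepSet_iff _ _).1 (hc.iIndepSet_weakSlot t) (Finset.range L)
    (f := fun n => (weakSlot h t n)ᶜ) fun n _ =>
      (MeasurableSpace.measurableSet_generateFrom (Set.mem_singleton _)).compl
  have hw : ∀ n, μ.real (weakSlot h t n) =
      (1 - (gaussianReal 0 1).real {x | t < x ^ 2}) ^ L := fun n => by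
    have h1 := hc.measure_biInter_weakSlot t {n}
    simp only [Finset.mem_singleton, Set.iInter_iInter_eq_left, Finset.prod_singleton] at h1
    have hcompl : {x : ℝ | t < x ^ 2}ᶜ = {x | x ^ 2 ≤ t} := by ext x; simp
    rw [measureReal_def, h1, ENNReal.toReal_pow, ← measureReal_def, ← hcompl,
      probReal_compl_eq_one_sub]
    exact measurableSet_lt measurable_const (by fun_prop)
  rw [measureReal_def, strongSlots_eq, hi, ENNReal.toReal_prod]
  simp only [← measureReal_def]
  rw [Finset.prod_congr rfl fun n _ => ?_, Finset.prod_const, Finset.card_range]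
  rw [probReal_compl_eq_one_sub (hc.measurableSet_weakSlot t n), hw]

/-- Two elementary estimates: `exp(-2q) ≤ 1 - q ≤ 1 - p` for `0 ≤ q ≤ 1/2` bounds a weak slot's
probability from below, and `1 - x ≤ exp(-x)` handles the power over slots. -/
theorem measureReal_strongSlots_le [IsProbabilityMeasure μ] {t q : ℝ}
    (hq : (gaussianReal 0 1).real {x | t < x ^ 2} ≤ q) (hq2 : q ≤ 1 / 2) :
    μ.real (strongSlots h t) ≤ Real.exp (-(L * Real.exp (-(2 * L * q)))) := by
  rw [hc.measureReal_strongSlots t]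
  set p := (gaussianReal 0 1).real {x | t < x ^ 2}
  have hp0 : 0 ≤ p := measureReal_nonneg
  have h1 : Real.exp (-(2 * q)) ≤ 1 - p := by
    rw [← Real.le_log_iff_exp_le (by linarith)]
    have h2 := Real.one_sub_inv_le_log_of_pos (x := 1 - q) (by linarith)
    have h3 : Real.log (1 - q) ≤ Real.log (1 - p) := Real.log_le_log (by linarith) (by linarith)
    have h4 : (1 - q)⁻¹ ≤ 1 + 2 * q := by
      rw [inv_le_iff_one_le_mul₀ (by linarith)]
      nlinarith
    linarith
  have h2 : Real.exp (-(2 * L * q)) ≤ (1 - p) ^ L := by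
    calc _ = Real.exp (-(2 * q)) ^ L := by rw [← Real.exp_nat_mul]; congr 1; ring
      _ ≤ _ := by gcongr
  have h3 : (1 - p) ^ L ≤ 1 := pow_le_one₀ (by linarith) (by linarith)
  calc _ ≤ Real.exp (-((1 - p) ^ L)) ^ L := by
        refine pow_le_pow_left₀ (by linarith) ?_ L
        have := Real.add_one_le_exp (-((1 - p) ^ L))
        linarith
    _ = Real.exp (-(L * (1 - p) ^ L)) := by rw [← Real.exp_nat_mul]; congr 1; ring
    _ ≤ _ := by gcongr

/-! ### Mean gain on the strong event -/

theorem integrable_pow (n : ℕ) (l : Fin L) (k : ℕ) : Integrable (fun ω => h n l ω ^ k) μ := by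
  have h1 : Integrable (fun x : ℝ => x ^ k) (gaussianReal 0 1) :=
    integrable_pow_of_integrable_exp_mul (t := 1) one_ne_zero
      (integrable_exp_mul_gaussianReal _) (integrable_exp_mul_gaussianReal _) k
  rw [← hc.law n l] at h1
  exact h1.comp_measurable (hc.measurable n l)

theorem integral_pow (n : ℕ) (l : Fin L) (k : ℕ) :
    ∫ ω, h n l ω ^ k ∂μ = ∫ x, x ^ k ∂gaussianReal 0 1 := by
  rw [← hc.law n l, integral_map (hc.measurable n l).aemeasurable (by fun_prop)]

/-- The total gain of the first slot, on the event that all the first `L` slots are strong. -/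
theorem integrable_strongGain (t : ℝ) :
    Integrable ((strongSlots h t).indicator fun ω => ∑ l, h 0 l ω ^ 2) μ :=
  (integrable_finsetSum _ fun l _ => hc.integrable_pow 0 l 2).indicator
    (hc.measurableSet_strongSlots t)

/-- Crude bound, used for the finitely many small `L`. -/
theorem integral_strongGain_le (t : ℝ) :
    ∫ ω, (strongSlots h t).indicator (fun ω => ∑ l, h 0 l ω ^ 2) ω ∂μ ≤
      L * ∫ x, x ^ 2 ∂gaussianReal 0 1 := by
  calc _ ≤ ∫ ω, ∑ l, h 0 l ω ^ 2 ∂μ :=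
        integral_mono (hc.integrable_strongGain t)
          (integrable_finsetSum _ fun l _ => hc.integrable_pow 0 l 2)
          (Set.indicator_le_self' fun ω _ => Finset.sum_nonneg fun _ _ => sq_nonneg _)
    _ = _ := by
      rw [integral_finsetSum _ fun l _ => hc.integrable_pow 0 l 2]
      simp [hc.integral_pow]

/-- Pointwise `h² ≤ h⁴/(2L²) + L²/2`, summed over the `L` users. This separates the gains from the
strong event, on which slot `0` depends, at the cost of a polynomial factor on its probability. -/
theorem integral_strongGain_le_add [IsProbabilityMeasure μ] (t : ℝ) (hL : 0 < L) :
    ∫ ω, (strongSlots h t).indicator (fun ω => ∑ l, h 0 l ω ^ 2) ω ∂μ ≤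
      (∫ x, x ^ 4 ∂gaussianReal 0 1) / (2 * L) + L ^ 3 * μ.real (strongSlots h t) / 2 := by
  have hL0 : (0 : ℝ) < L := by exact_mod_cast hL
  have hA := hc.measurableSet_strongSlots t
  have hone : Integrable ((strongSlots h t).indicator fun _ => (1 : ℝ)) μ :=
    (integrable_const _).indicator hA
  have i4 : ∀ l, Integrable (fun ω => h 0 l ω ^ 4 / (2 * L ^ 2)) μ :=
    fun l => (hc.integrable_pow 0 l 4).div_const _
  calc _ ≤ ∫ ω, (∑ l, h 0 l ω ^ 4 / (2 * L ^ 2)) +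
          L ^ 3 / 2 * (strongSlots h t).indicator (fun _ => (1 : ℝ)) ω ∂μ := by
        refine integral_mono (hc.integrable_strongGain t)
          ((integrable_finsetSum _ fun l _ => i4 l).add (hone.const_mul _)) fun ω => ?_
        by_cases hω : ω ∈ strongSlots h t
        · have key : ∀ l, h 0 l ω ^ 2 ≤ h 0 l ω ^ 4 / (2 * L ^ 2) + L ^ 2 / 2 := fun l => by
            have := sq_nonneg (h 0 l ω ^ 2 / L - L)
            have e : (h 0 l ω ^ 2 / L - L) ^ 2 =
              2 * (h 0 l ω ^ 4 / (2 * L ^ 2) + L ^ 2 / 2) - 2 * h 0 l ω ^ 2 := by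
              field_simp
              ring
            linarith
          have := Finset.sum_le_sum fun l (_ : l ∈ Finset.univ) => key l
          simp only [Set.indicator_of_mem hω]
          refine this.trans_eq ?_
          rw [Finset.sum_add_distrib]
          simp
          ring
        · simp only [Set.indicator_of_notMem hω]
          rw [mul_zero, add_zero]
          exact Finset.sum_nonneg fun _ _ => by positivity
    _ = _ := by
      rw [integral_add (integrable_finsetSum _ fun l _ => i4 l) (hone.const_mul _),
        integral_finsetSum _ fun l _ => i4 l, integral_const_mul, integral_indicator hA]
      simp only [integral_div, hc.integral_pow]
      simp
      field_simp

end IsChannel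

/-! ### Jensen's inequality -/

namespace SchedulingAlgorithm

variable [IsProbabilityMeasure μ] (𝒜 : SchedulingAlgorithm L Ω) (K : Type*) [Field K]

/-- Off the strong event some slot has all gains at most `t`; on it the total gain `G` of slot `0`
dominates each gain there. So the sum-rate is at most `½ log(1 + P (t + G))`, and the tangent line
of this concave function at `m` gives integrability and the bound together. -/
theorem integrable_sumRate_and_integral_le {P t m : ℝ} (hP : 0 < P) (hL : 0 < L) (ht : 0 ≤ t)
    (hc : IsChannel μ h)
    (hm : t + ∫ ω, (strongSlots h t).indicator (fun ω => ∑ l, h 0 l ω ^ 2) ω ∂μ ≤ m) :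
    Integrable (𝒜.sumRate K P h) μ ∧
      ∫ ω, 𝒜.sumRate K P h ω ∂μ ≤ 1 / 2 * Real.logb 2 (1 + P * m) := by
  set G := (strongSlots h t).indicator fun ω => ∑ l, h 0 l ω ^ 2
  have hG0 : ∀ ω, 0 ≤ G ω := Set.indicator_nonneg fun ω _ =>
    Finset.sum_nonneg fun _ _ => sq_nonneg _
  have hGi : Integrable G μ := hc.integrable_strongGain t
  have hm0 : 0 ≤ m := by
    have : 0 ≤ ∫ ω, G ω ∂μ := integral_nonneg hG0
    linarith
  have hlog2 : 0 < Real.log 2 := Real.log_pos (by norm_num)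
  have hQ : 0 < 1 + P * m := by positivity
  have hrate : ∀ ω, 𝒜.sumRate K P h ω ≤ 1 / 2 * Real.logb 2 (1 + P * (t + G ω)) := fun ω => by
    by_cases hω : ω ∈ strongSlots h t
    · refine 𝒜.sumRate_le K hP h ω hL fun l => ?_
      have : h 0 l ω ^ 2 ≤ ∑ l, h 0 l ω ^ 2 :=
        Finset.single_le_sum (f := fun l => h 0 l ω ^ 2) (fun _ _ => sq_nonneg _)
          (Finset.mem_univ l)
      simp only [G, Set.indicator_of_mem hω]
      linarith
    · have hω' := hω
      simp only [strongSlots, Set.mem_ofPred_eq, not_forall, not_exists, not_lt] at hω'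
      obtain ⟨n, hn, hl⟩ := hω'
      refine 𝒜.sumRate_le K hP h ω hn fun l => ?_
      simp only [G, Set.indicator_of_notMem hω, add_zero]
      exact hl l
  -- Slope at `m` of `y ↦ ½ logb 2 (1 + P y)`; as it is nonnegative, an upper bound `m` for the mean
  -- suffices.
  set c := P / (1 + P * m) / (2 * Real.log 2)
  have hc0 : 0 ≤ c := by positivity
  have htan : ∀ ω, 𝒜.sumRate K P h ω ≤
      1 / 2 * Real.logb 2 (1 + P * m) + c * (t + G ω - m) := fun ω => by
    refine (hrate ω).trans ?_
    have hy : 0 < 1 + P * (t + G ω) := by have := hG0 ω; positivity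
    have h1 := Real.log_le_sub_one_of_pos (div_pos hy hQ)
    rw [Real.log_div hy.ne' hQ.ne'] at h1
    have h2 : (1 + P * (t + G ω)) / (1 + P * m) - 1 = P / (1 + P * m) * (t + G ω - m) := by
      field_simp
      ring
    have h3 : c * (t + G ω - m) =
        1 / 2 * ((P / (1 + P * m) * (t + G ω - m)) / Real.log 2) := by
      simp only [c]; field_simp
    rw [h3, ← mul_add, Real.logb, Real.logb, ← add_div]
    gcongr
    linarith
  have hY : Integrable (fun ω => t + G ω) μ := (integrable_const t).add hGi
  have hYm : Integrable (fun ω => t + G ω - m) μ := hY.sub (integrable_const m)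
  have hi : Integrable (fun ω => 1 / 2 * Real.logb 2 (1 + P * m) + c * (t + G ω - m)) μ :=
    (integrable_const _).add (hYm.const_mul c)
  have hs : Integrable (𝒜.sumRate K P h) μ := by
    refine hi.mono' (𝒜.measurable_sumRate K P hc.measurable).aestronglyMeasurable
      (ae_of_all _ fun ω => ?_)
    rw [Real.norm_of_nonneg (𝒜.sumRate_nonneg K P h ω)]
    exact htan ω
  refine ⟨hs, (integral_mono hs hi htan).trans ?_⟩
  have e : ∫ ω, 1 / 2 * Real.logb 2 (1 + P * m) + c * (t + G ω - m) ∂μ =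
      1 / 2 * Real.logb 2 (1 + P * m) + c * (t + ∫ ω, G ω ∂μ - m) := by
    rw [integral_add (integrable_const _) (hYm.const_mul c), integral_const_mul c,
      integral_sub hY (integrable_const m), integral_add (integrable_const t) hGi]
    simp
  rw [e]
  nlinarith

end SchedulingAlgorithm

end Channel

/-! ### Asymptotics of the gain level -/

/-- The gain level exceeded in every slot only with small probability. -/
def gainLevel (L : ℕ) : ℝ := 2 * Real.log L - 3 / 2 * Real.log (Real.log L)

/-- The extreme value centering of the maximal gain, with the constant of the sum-rate bound. -/
def gainBound (L : ℕ) : ℝ :=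
  2 * Real.log L - Real.log (Real.log L) - 2 * Real.log (Real.Gamma (1 / 2))
    + Real.eulerMascheroniConstant / 2

theorem tendsto_log_natCast : Tendsto (fun L : ℕ => Real.log L) atTop atTop :=
  Real.tendsto_log_atTop.comp tendsto_natCast_atTop_atTop

theorem eventually_log_le_self : ∀ᶠ x : ℝ in atTop, Real.log x ≤ x := by
  filter_upwards [eventually_gt_atTop 0] with x hx
  linarith [Real.log_le_sub_one_of_pos hx]

/-- The coefficient `3/2` could be any number strictly between `1` and `2`: above `1` it leaves room
below `gainBound`, and below `2` it makes `L exp(-t/2)` a power of `ln L` with exponent less than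
`1`. `C` stands for the fourth moment. -/
theorem eventually_gainLevel (C : ℝ) : ∀ᶠ L : ℕ in atTop,
    0 ≤ gainLevel L ∧ 2 * Real.exp (-gainLevel L / 2) ≤ 1 / 2 ∧ gainLevel L + 1 ≤ gainBound L ∧
    C / (2 * L) + L ^ 3 *
      Real.exp (-(L * Real.exp (-(2 * L * (2 * Real.exp (-gainLevel L / 2)))))) / 2 ≤ 1 := by
  have hC : Tendsto (fun x : ℝ => C / (2 * Real.exp x)) atTop (𝓝 0) :=
    Tendsto.div_atTop tendsto_const_nhds
      (Real.tendsto_exp_atTop.const_mul_atTop (by norm_num))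
  have hE : Tendsto (fun x : ℝ => Real.exp (x / 2) ^ 6 * Real.exp (-Real.exp (x / 2)))
      atTop (𝓝 0) :=
    (Real.tendsto_pow_mul_exp_neg_atTop_nhds_zero 6).comp
      (Real.tendsto_exp_atTop.comp (tendsto_id.atTop_div_const (by norm_num)))
  -- Here `x = ln L`. The bound `8 ≤ x` gives `t ≥ x/2 ≥ 4`, and `32 ≤ log x` gives `x^(1/4) ≥ 8`.
  have ev : ∀ᶠ x : ℝ in atTop, Real.log x ≤ x ∧ 8 ≤ x ∧ 32 ≤ Real.log x ∧
      1 + 2 * Real.log (Real.Gamma (1 / 2)) - Real.eulerMascheroniConstant / 2 ≤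
        1 / 2 * Real.log x ∧
      C / (2 * Real.exp x) ≤ 1 / 2 ∧
      Real.exp (x / 2) ^ 6 * Real.exp (-Real.exp (x / 2)) ≤ 1 := by
    filter_upwards [eventually_log_le_self, eventually_ge_atTop 8,
      Real.tendsto_log_atTop.eventually_ge_atTop 32,
      (Real.tendsto_log_atTop.const_mul_atTop (by norm_num : (0 : ℝ) < 1 / 2)).eventually_ge_atTop
        (1 + 2 * Real.log (Real.Gamma (1 / 2)) - Real.eulerMascheroniConstant / 2),
      hC.eventually_le_const (by norm_num : (0 : ℝ) < 1 / 2),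
      hE.eventually_le_const one_pos] with x h1 h2 h3 h4 h5 h6
    exact ⟨h1, h2, h3, h4, h5, h6⟩
  filter_upwards [tendsto_log_natCast.eventually ev, eventually_gt_atTop 0] with L hx hL
  obtain ⟨h1, h2, h3, h4, h5, h6⟩ := hx
  have hLx : (L : ℝ) = Real.exp (Real.log L) :=
    (Real.exp_log (by exact_mod_cast hL)).symm
  unfold gainLevel gainBound
  set x := Real.log L
  refine ⟨by linarith, ?_, by linarith, ?_⟩
  · have e : -(2 * x - 3 / 2 * Real.log x) / 2 ≤ -2 := by linarith
    have h7 : Real.exp (-(2 * x - 3 / 2 * Real.log x) / 2) ≤ Real.exp (-2) := Real.exp_le_exp.2 e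
    have h8 : Real.exp (-2) ≤ 1 / 4 := by
      have h9 : (2 : ℝ) ≤ Real.exp 1 := by linarith [Real.add_one_le_exp (1 : ℝ)]
      rw [Real.exp_neg, show (2 : ℝ) = 1 + 1 by norm_num, Real.exp_add,
        inv_le_comm₀ (by positivity) (by norm_num)]
      nlinarith
    linarith
  · rw [hLx]
    have hx : Real.exp (Real.log x) = x := Real.exp_log (by linarith)
    -- The left side is `4 x^(3/4)`. Being at most `x/2`, it leaves `exp(-√L)`, which absorbs `L³ =
    -- (√L)^6`.
    have h7 : 2 * Real.exp x * (2 * Real.exp (-(2 * x - 3 / 2 * Real.log x) / 2)) ≤ x / 2 := by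
      have e1 : 2 * Real.exp x * (2 * Real.exp (-(2 * x - 3 / 2 * Real.log x) / 2)) =
          4 * Real.exp (3 / 4 * Real.log x) := by
        rw [show 2 * Real.exp x * (2 * Real.exp (-(2 * x - 3 / 2 * Real.log x) / 2)) =
          4 * (Real.exp x * Real.exp (-(2 * x - 3 / 2 * Real.log x) / 2)) by ring, ← Real.exp_add]
        congr 2
        ring
      have e2 : x = Real.exp (3 / 4 * Real.log x) * Real.exp (1 / 4 * Real.log x) := by
        rw [← Real.exp_add, ← add_mul]
        norm_num [hx]
      have e3 : 8 ≤ Real.exp (1 / 4 * Real.log x) := by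
        linarith [Real.add_one_le_exp (1 / 4 * Real.log x)]
      rw [e1]
      nlinarith [Real.exp_pos (3 / 4 * Real.log x)]
    have h8 : Real.exp (x / 2) ≤ Real.exp x *
        Real.exp (-(2 * Real.exp x * (2 * Real.exp (-(2 * x - 3 / 2 * Real.log x) / 2)))) := by
      rw [← Real.exp_add]
      exact Real.exp_le_exp.2 (by linarith)
    have h9 : Real.exp x ^ 3 = Real.exp (x / 2) ^ 6 := by
      rw [← Real.exp_nat_mul, ← Real.exp_nat_mul]
      congr 1
      push_cast
      ring
    have h10 : Real.exp x ^ 3 * Real.exp (-(Real.exp x * Real.exp (-(2 * Real.exp x *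
        (2 * Real.exp (-(2 * x - 3 / 2 * Real.log x) / 2)))))) ≤ 1 := by
      refine le_trans ?_ h6
      rw [h9]
      gcongr
    linarith

/-- With `x = ln L`, `1 + P * gainBound L ≤ (1 + 2P) x ≤ x^(1+η)`, and `ln L ≤ log₂ L`. -/
theorem eventually_rate_le {P η : ℝ} (hP : 0 < P) (hη : 0 < η) : ∀ᶠ L : ℕ in atTop,
    1 / 2 * Real.logb 2 (1 + P * gainBound L) ≤
      (1 + η) * (1 / 2 * Real.logb 2 (Real.logb 2 L)) := by
  have hpow := tendsto_rpow_atTop hη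
  have ev : ∀ᶠ x : ℝ in atTop, 1 ≤ x ∧ 1 + 2 * P ≤ x ^ η ∧
      -2 * Real.log (Real.Gamma (1 / 2)) + Real.eulerMascheroniConstant / 2 ≤ Real.log x := by
    filter_upwards [eventually_ge_atTop 1, hpow.eventually_ge_atTop (1 + 2 * P),
      Real.tendsto_log_atTop.eventually_ge_atTop
        (-2 * Real.log (Real.Gamma (1 / 2)) + Real.eulerMascheroniConstant / 2)] with x h1 h2 h3
    exact ⟨h1, h2, h3⟩
  -- Only `0 ≤ gainLevel L ≤ gainBound L - 1` is taken from the second fact, so `C = 0` is as good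
  -- as any.
  filter_upwards [tendsto_log_natCast.eventually ev, eventually_gainLevel 0] with L hx hg
  obtain ⟨h1, h2, h3⟩ := hx
  obtain ⟨hg0, -, hg1, -⟩ := hg
  have hb : gainBound L ≤ 2 * Real.log L := by unfold gainBound; linarith
  have hlog2 : Real.log 2 ≤ 1 := by linarith [Real.log_le_sub_one_of_pos (two_pos : (0 : ℝ) < 2)]
  have hu : Real.log L ≤ Real.logb 2 L := by
    rw [Real.logb, le_div_iff₀ (Real.log_pos (by norm_num))]
    nlinarith
  have hu0 : 0 < Real.logb 2 L := by linarith
  rw [mul_left_comm, ← Real.logb_rpow_eq_mul_logb_of_pos hu0]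
  refine mul_le_mul_of_nonneg_left (Real.logb_le_logb_of_le (by norm_num) ?_ ?_) (by norm_num)
  · have : 0 ≤ gainBound L := by linarith
    positivity
  calc 1 + P * gainBound L ≤ 1 + P * (2 * Real.log L) := by gcongr
    _ ≤ Real.log L * (1 + 2 * P) := by nlinarith
    _ ≤ Real.log L * Real.log L ^ η := by gcongr
    _ = Real.log L ^ (1 + η) := by rw [Real.rpow_add (by linarith), Real.rpow_one]
    _ ≤ _ := by gcongr

/-! ### The correction term and the final bound -/

/-- From some number of users on, the gain level satisfies all estimates used in the
sum-rate bound. -/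
theorem exists_threshold : ∃ L₀ : ℕ, ∀ L : ℕ, L₀ ≤ L → 0 < L ∧
    0 ≤ gainLevel L ∧ 2 * Real.exp (-gainLevel L / 2) ≤ 1 / 2 ∧ gainLevel L + 1 ≤ gainBound L ∧
    (∫ x, x ^ 4 ∂gaussianReal 0 1) / (2 * L) + L ^ 3 *
      Real.exp (-(L * Real.exp (-(2 * L * (2 * Real.exp (-gainLevel L / 2)))))) / 2 ≤ 1 :=
  eventually_atTop.1 ((eventually_gt_atTop 0).and (eventually_gainLevel _))

/-- A number of users as in `exists_threshold`. -/
def userThreshold : ℕ := exists_threshold.choose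

/-- The `o(1)` term of the sum-rate bound. -/
def correction (L : ℕ) : ℝ :=
  if userThreshold ≤ L then 0 else L * (∫ x, x ^ 2 ∂gaussianReal 0 1) + |gainBound L|

theorem tendsto_correction : Tendsto correction atTop (𝓝 0) :=
  tendsto_const_nhds.congr' <| by
    filter_upwards [eventually_ge_atTop userThreshold] with L hL
    simp [correction, hL]

theorem gainBound_add_correction_nonneg (L : ℕ) : 0 ≤ gainBound L + correction L := by
  unfold correction
  split_ifs with hL
  · obtain ⟨-, h0, -, h1, -⟩ := exists_threshold.choose_spec L hL
    linarith
  · have h2 : 0 ≤ ∫ x : ℝ, x ^ 2 ∂gaussianReal 0 1 := integral_nonneg fun _ => sq_nonneg _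
    have h3 := neg_abs_le (gainBound L)
    have : 0 ≤ (L : ℝ) * ∫ x : ℝ, x ^ 2 ∂gaussianReal 0 1 := by positivity
    linarith

namespace SchedulingAlgorithm

/-- Past the threshold the bound holds with zero correction. Below it, level `t = 0` and the crude
mean `L * ∫ x²` suffice; adding `|gainBound L|` offsets a possibly negative centering. Neither
choice involves `P`, `K` or the algorithm. -/
theorem sumRate_bound {P : ℝ} (hP : 0 < P) {L : ℕ} (hL : 0 < L) (K : Type*) [Field K]
    {Ω : Type*} [MeasurableSpace Ω] {μ : Measure Ω} [IsProbabilityMeasure μ]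
    {h : ℕ → Fin L → Ω → ℝ} (hc : IsChannel μ h) (𝒜 : SchedulingAlgorithm L Ω) :
    Integrable (𝒜.sumRate K P h) μ ∧
      ∫ ω, 𝒜.sumRate K P h ω ∂μ ≤
        1 / 2 * Real.logb 2 (1 + P * (gainBound L + correction L)) := by
  unfold correction
  split_ifs with hL0
  · obtain ⟨-, h0, hq, h1, h2⟩ := exists_threshold.choose_spec L hL0
    refine 𝒜.integrable_sumRate_and_integral_le K hP hL h0 hc ?_
    have h3 := hc.integral_strongGain_le_add (gainLevel L) hL
    have h4 := hc.measureReal_strongSlots_le (measureReal_gaussian_lt_sq_le h0) hq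
    have h5 : (L : ℝ) ^ 3 * μ.real (strongSlots h (gainLevel L)) ≤ L ^ 3 *
      Real.exp (-(L * Real.exp (-(2 * L * (2 * Real.exp (-gainLevel L / 2)))))) := by gcongr
    linarith
  · refine 𝒜.integrable_sumRate_and_integral_le K hP hL le_rfl hc ?_
    have h3 := hc.integral_strongGain_le 0
    have h4 := neg_abs_le (gainBound L)
    linarith

end SchedulingAlgorithm

end CF

end

theorem theorem7 :
    (∃ ε : ℕ → ℝ, Tendsto ε atTop (𝓝 0) ∧
      ∀ P : ℝ, 0 < P → ∀ L : ℕ, 2 ≤ L →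
        0 < 1 + P * (2 * Real.log L - Real.log (Real.log L) - 2 * Real.log (Real.Gamma (1 / 2))
            + Real.eulerMascheroniConstant / 2 + ε L) ∧
        ∀ (K : Type*) [Field K] (Ω : Type*) [MeasurableSpace Ω] (μ : Measure Ω)
          [IsProbabilityMeasure μ] (h : ℕ → Fin L → Ω → ℝ), CF.IsChannel μ h →
          ∀ 𝒜 : CF.SchedulingAlgorithm L Ω,
            Integrable (𝒜.sumRate K P h) μ ∧
            ∫ ω, 𝒜.sumRate K P h ω ∂μ ≤
              1 / 2 * Real.logb 2 (1 + P * (2 * Real.log L - Real.log (Real.log L)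
                - 2 * Real.log (Real.Gamma (1 / 2))
                + Real.eulerMascheroniConstant / 2 + ε L))) ∧
    (∀ P : ℝ, 0 < P → ∀ η : ℝ, 0 < η → ∃ L₀ : ℕ, ∀ L : ℕ, L₀ ≤ L →
        ∀ (K : Type*) [Field K] (Ω : Type*) [MeasurableSpace Ω] (μ : Measure Ω)
          [IsProbabilityMeasure μ] (h : ℕ → Fin L → Ω → ℝ), CF.IsChannel μ h →
          ∀ 𝒜 : CF.SchedulingAlgorithm L Ω,
            ∫ ω, 𝒜.sumRate K P h ω ∂μ ≤
              (1 + η) * (1 / 2 * Real.logb 2 (Real.logb 2 L))) := by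
  refine ⟨⟨CF.correction, CF.tendsto_correction, fun P hP L hL => ⟨?_, ?_⟩⟩, fun P hP η hη => ?_⟩
  · have := CF.gainBound_add_correction_nonneg L
    exact add_pos_of_pos_of_nonneg one_pos (mul_nonneg hP.le this)
  · intro K _ Ω _ μ _ h hc 𝒜
    exact 𝒜.sumRate_bound hP (by omega) K hc
  · obtain ⟨L₀, hL₀⟩ := eventually_atTop.1 (CF.eventually_rate_le hP hη)
    -- Beyond `userThreshold` the correction is exactly zero; the `1` ensures `0 < L`.
    refine ⟨max L₀ (max 1 CF.userThreshold), fun L hL K _ Ω _ μ _ h hc 𝒜 => ?_⟩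
    have h1 : CF.correction L = 0 := if_pos (by omega)
    have h2 := (𝒜.sumRate_bound hP (by omega) K hc).2
    rw [h1, add_zero] at h2
    exact h2.trans (hL₀ L (by omega))
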